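/- Let $d,N\ge 1$ be integers, $D=\{1,\dots,d\}$, $\lambda,\mu,\xi>0$, and let $C=(c_{l,j})_{l,j\in D}$ be an irreducible stochastic matrix. Let $\mathbf X_t=(\mathcal N(t),J(t))$, $t\ge 0$, be a time-homogeneous continuous-time Markov chain on $\{0,\dots,N\}\times D$ started at $(0,l_0)$, $l_0\in D$, with the following transition rates: from $(0,l)$ to $(1,j)$ at rate $c_{l,j}\lambda N$ ($l,j\in D$); and, for $1\le k\le N$, from $(k,j)$ to $(k+1,j)$ at rate $\lambda(N-k)$ (if $k<N$), from $(k,j)$ to $(k-1,j)$ at rate $\mu(N+k)$, and, in addition, from $(k,j)$ to $(0,j)$ at rate $\xi$ (a catastrophe), so that the total rate from $(1,j)$ to $(0,j)$ is $\mu(N+1)+\xi$; all other transitions have rate $0$. Then, as $t\to\infty$, $P(\mathcal N(t)=k)$ converges to a limit $\rho(k)$ for each $k=0,\dots,N$, and for every $z\in[0,1]$ the probability generating function $F(z,t)=E[z^{\mathcal N(t)}]$ converges to $F(z)=\sum_{k=0}^N\rho(k)z^k$. For every $z\in(0,1]$, $$ \begin{aligned} F(z)={}&-\frac{N\mu(1-z)(\lambda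 z+\mu)^N}{(\lambda+\mu)^{2N}z^N}\,g(\lambda,\mu,\xi,N)\sum_{j=0}^{N-1}\binom{N-1}{j}[(\lambda+\mu)z]^{N-j-1}[\mu(1-z)]^j\\ &\qquad\times\frac{\Gamma(j+1)\,\Gamma\!\left(\frac{\xi}{\lambda+\mu}+1\right)}{\Gamma\!\left(j+\frac{\xi}{\lambda+\mu}+2\right)}\;{}_2F_1\!\left(\tfrac{\xi}{\lambda+\mu}+1,-N,\tfrac{\xi}{\lambda+\mu}+j+2;-\tfrac{\lambda(1-z)}{\lambda z+\mu}\right)\\ &+\frac{(\lambda z+\mu)^N}{(\lambda+\mu)^{2N}z^N}\sum_{j=0}^{N}\binom{N}{j}[(\lambda+\mu)z]^{N-j}[\mu(1-z)]^j\\ &\qquad\times\frac{\Gamma(j+1)\,\Gamma\!\left(\frac{\xi}{\lambda+\mu}+1\right)}{\Gamma\!\left(j+\frac{\xi}{\lambda+\mu}+1\right)}\;{}_2F_1\!\left(\tfrac{\xi}{\lambda+\mu},-N,\tfrac{\xi}{\lambda+\mu}+j+1;-\tfrac{\lambda(1-z)}{\lambda z+\mu}\right), \end{aligned} $$ where $$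 g(\lambda,\mu,\xi,N)=\frac{{}_2F_1\!\left(\frac{\xi}{\lambda+\mu},-N,\frac{\xi}{\lambda+\mu}+N+1;-\frac{\lambda}{\mu}\right)}{{}_2F_1\!\left(\frac{\xi}{\lambda+\mu}+1,-N,\frac{\xi}{\lambda+\mu}+N+1;-\frac{\lambda}{\mu}\right)} $$ and ${}_2F_1(a,b,c;x)=\sum_{n\ge 0}\frac{(a)_n(b)_n}{(c)_n\,n!}x^n$ is the Gauss hypergeometric function (here a finite sum, since $b=-N$), with the convention $0^0=1$. -/

import Mathlib

open MeasureTheory Filter Topology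

noncomputable section

namespace QBD

/-- A standard transition function `t ↦ T t`, `t ≥ 0`, on a finite state space `S`, with
transition rates `Q`: stochastic matrices, Chapman-Kolmogorov, and
`T h x y = δ_{x,y} + Q x y * h + o(h)` as `h → 0⁺`. (Values at negative times are irrelevant.) -/
structure IsTransitionFunction {S : Type*} [Fintype S] [DecidableEq S]
    (Q : Matrix S S ℝ) (T : ℝ → Matrix S S ℝ) : Prop where
  stochastic : ∀ t, 0 ≤ t → T t ∈ Matrix.rowStochastic ℝ S
  zero : T 0 = 1
  add : ∀ s t, 0 ≤ s → 0 ≤ t → T (s + t) = T s * T t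
  rates : ∀ x y,
    Tendsto (fun h : ℝ => (T h x y - (1 : Matrix S S ℝ) x y) / h) (𝓝[>] 0) (𝓝 (Q x y))

/-- `X = (X t)_{t ≥ 0}` is a time-homogeneous Markov process on the finite state space `S` with
transition rates `Q`, started at `x₀`. The Markov property is stated with respect to the natural
filtration: for `H` in the sigma-algebra generated by `X u`, `0 ≤ u ≤ s`,
`ℙ (H, X s = x, X (s + t) = y) = ℙ (H, X s = x) * T t x y`. -/
structure IsMarkovJumpProcess {Ω S : Type*} [MeasurableSpace Ω] [Fintype S] [DecidableEq S]
    [MeasurableSpace S] (Pr : Measure Ω) (Q : Matrix S S ℝ) (x₀ : S) (X : ℝ → Ω → S) : Prop where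
  measurable : ∀ t, 0 ≤ t → Measurable (X t)
  initial : ∀ᵐ ω ∂Pr, X 0 ω = x₀
  markov : ∃ T : ℝ → Matrix S S ℝ, IsTransitionFunction Q T ∧
    ∀ s t, 0 ≤ s → 0 ≤ t → ∀ H : Set Ω,
      MeasurableSet[⨆ u ∈ Set.Icc 0 s, MeasurableSpace.comap (X u) inferInstance] H →
      ∀ x y, Pr.real (H ∩ {ω | X s ω = x} ∩ {ω | X (s + t) ω = y})
        = Pr.real (H ∩ {ω | X s ω = x}) * T t x y

/-- The generator on the states `(level, phase)` in `{0,…,N} × {1,…,d}`. The four summands are the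
rates of: birth at level `0` (with a change of phase according to `C`), birth at level `k ≥ 1`,
death, and catastrophe; what is subtracted on the diagonal is the total rate of leaving. -/
def generator (lam mu xi : ℝ) (d N : ℕ) (C : Matrix (Fin d) (Fin d) ℝ) :
    Matrix (Fin (N + 1) × Fin d) (Fin (N + 1) × Fin d) ℝ := fun x y =>
  (if (x.1 : ℕ) = 0 ∧ (y.1 : ℕ) = 1 then C x.2 y.2 * (lam * N) else 0)
  + (if 1 ≤ (x.1 : ℕ) ∧ (y.1 : ℕ) = x.1 + 1 ∧ y.2 = x.2 then lam * ((N : ℝ) - (x.1 : ℕ)) else 0)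
  + (if (x.1 : ℕ) = y.1 + 1 ∧ y.2 = x.2 then mu * ((N : ℝ) + (x.1 : ℕ)) else 0)
  + (if 1 ≤ (x.1 : ℕ) ∧ (y.1 : ℕ) = 0 ∧ y.2 = x.2 then xi else 0)
  - (if x = y then
      lam * ((N : ℝ) - (x.1 : ℕ)) + (if 1 ≤ (x.1 : ℕ) then mu * ((N : ℝ) + (x.1 : ℕ)) + xi else 0)
     else 0)

/-- The quasi-birth-death process with catastrophes `X t = (𝓝(t), J(t))`, started at level `0` in
phase `l₀`. -/
def IsCatastropheQBD {Ω : Type*} [MeasurableSpace Ω] (Pr : Measure Ω) (lam mu xi : ℝ) (d N : ℕ)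
    (C : Matrix (Fin d) (Fin d) ℝ) (l₀ : Fin d) (X : ℝ → Ω → Fin (N + 1) × Fin d) : Prop :=
  IsMarkovJumpProcess Pr (generator lam mu xi d N C) (0, l₀) X

/-- `p(k,t)`: the probability that the level at time `t` is `k`. -/
def levelProb {Ω : Type*} [MeasurableSpace Ω] (Pr : Measure Ω) {d N : ℕ}
    (X : ℝ → Ω → Fin (N + 1) × Fin d) (k : Fin (N + 1)) (t : ℝ) : ℝ :=
  Pr.real {ω | (X t ω).1 = k}

/-- `F(z,t) = E[z ^ 𝓝(t)]`: the probability generating function of the level at time `t`. -/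
def levelPGF {Ω : Type*} [MeasurableSpace Ω] (Pr : Measure Ω) {d N : ℕ}
    (X : ℝ → Ω → Fin (N + 1) × Fin d) (z t : ℝ) : ℝ :=
  ∫ ω, z ^ ((X t ω).1 : ℕ) ∂Pr

/-- The coefficient `g(λ,μ,ξ,N)`. -/
def g (lam mu xi : ℝ) (N : ℕ) : ℝ :=
  ordinaryHypergeometric (xi / (lam + mu)) (-(N : ℝ)) (xi / (lam + mu) + N + 1) (-lam / mu)
    / ordinaryHypergeometric (xi / (lam + mu) + 1) (-(N : ℝ)) (xi / (lam + mu) + N + 1)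
        (-lam / mu)

/-- The closed form of the asymptotic probability generating function (for `0 < z ≤ 1`). -/
def closedForm (lam mu xi : ℝ) (N : ℕ) (z : ℝ) : ℝ :=
  -(N * mu * (1 - z) * (lam * z + mu) ^ N / ((lam + mu) ^ (2 * N) * z ^ N)) * g lam mu xi N
    * ∑ j ∈ Finset.range N,
        ((N - 1).choose j : ℝ) * ((lam + mu) * z) ^ (N - j - 1) * (mu * (1 - z)) ^ j
        * (Real.Gamma (j + 1) * Real.Gamma (xi / (lam + mu) + 1)
            / Real.Gamma (j + xi / (lam + mu) + 2))
        * ordinaryHypergeometric (xi / (lam + mu) + 1) (-(N : ℝ)) (xi / (lam + mu) + j + 2)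
            (-(lam * (1 - z)) / (lam * z + mu))
  + (lam * z + mu) ^ N / ((lam + mu) ^ (2 * N) * z ^ N)
    * ∑ j ∈ Finset.range (N + 1),
        (N.choose j : ℝ) * ((lam + mu) * z) ^ (N - j) * (mu * (1 - z)) ^ j
        * (Real.Gamma (j + 1) * Real.Gamma (xi / (lam + mu) + 1)
            / Real.Gamma (j + xi / (lam + mu) + 1))
        * ordinaryHypergeometric (xi / (lam + mu)) (-(N : ℝ)) (xi / (lam + mu) + j + 1)
            (-(lam * (1 - z)) / (lam * z + mu))

end QBD

end

/-! Summing over the phases removes them: the rows of `C` sum to one, so the level is itself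
Markovian, with generator `Q` plus a reset to 0 at rate ξ. The law `p(t)` of the level then
satisfies `p(t + h) = p(t) + h (p(t) Q + ξ (δ₀ - p(t))) + o(h)`. If ρ solves the balance equations,
the source δ₀ cancels in `p - ρ`, and the ℓ¹ norm of this difference contracts by `1 - ξ h` up to
`o(h)`. Hence `p(t) → ρ`. A balanced ρ exists because `ξ I - Q` is diagonally dominant.

For the closed form, regard level `k` as `N + k` up and `N - k` down among `2N` independent
particles that fall at rate μ and rise at rate λ. With `s = 1 - exp(-(λ+μ)t)`, the generating
functions of one particle started up or down are `A = z + m(1-z)s` and `B = 1 - l(1-z)s`, where `l =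
λ/(λ+μ)` and `m = μ/(λ+μ)`. So `W k = A^(N+k) B^(N-k)` solves the backward equation, except at `k =
0`, where the level may not fall and a correction appears. At an exponential time of rate ξ, `s` has
density `a(1-s)^(a-1)` with `a = ξ/(λ+μ)`. Integrating by parts against this density turns the
balance equations into `IsBalanced.pgf_identity`. Its only unknown, `ρ 0`, is found by setting `z =
0`, and Euler's integral converts the remaining moments into ₂F₁. The integral is encoded by its
moments, so the closed form needs only polynomial algebra. -/

namespace QBD

/-! ### Beta moments of polynomials and terminating ₂F₁ -/

section Moments

open Polynomial

/-- The Pochhammer symbol `(x)_n` for real `x`. -/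
noncomputable abbrev poch (x : ℝ) (n : ℕ) : ℝ := (ascPochhammer ℝ n).eval x

lemma poch_zero (x : ℝ) : poch x 0 = 1 := by simp [poch]

lemma poch_pos {x : ℝ} (hx : 0 < x) (n : ℕ) : 0 < poch x n := ascPochhammer_pos n x hx

lemma Gamma_add_natCast {x : ℝ} (hx : 0 < x) (n : ℕ) :
    Real.Gamma (x + n) = poch x n * Real.Gamma x := by
  induction n with
  | zero => simp [poch_zero]
  | succ n ih =>
    have hne : x + n ≠ 0 := by positivity
    rw [Nat.cast_succ, ← add_assoc, Real.Gamma_add_one hne, ih, poch, poch,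
      ascPochhammer_succ_eval]
    ring

lemma poch_add (x : ℝ) (m n : ℕ) : poch x (m + n) = poch x m * poch (x + m) n := by
  rw [poch, ← ascPochhammer_mul]
  simp

/-- The terminating Gauss hypergeometric function as a binomial sum. -/
lemma ordinaryHypergeometric_neg_natCast (b c x : ℝ) (N : ℕ) :
    ordinaryHypergeometric b (-(N : ℝ)) c (-x)
      = ∑ i ∈ Finset.range (N + 1), (N.choose i : ℝ) * (poch b i / poch c i) * x ^ i := by
  rw [ordinaryHypergeometric_eq_tsum]
  dsimp only
  rw [tsum_eq_sum (s := Finset.range (N + 1))]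
  · refine Finset.sum_congr rfl fun i _ => ?_
    have h : (ascPochhammer ℝ i).eval (-(N : ℝ)) = (-1) ^ i * ((i.factorial : ℝ) * N.choose i) := by
      rw [ascPochhammer_eval_neg_eq_descPochhammer, descPochhammer_eval_eq_descFactorial,
        Nat.descFactorial_eq_factorial_mul_choose]
      push_cast
      ring
    have hf : (i.factorial : ℝ) ≠ 0 := by positivity
    have hs : ((-1 : ℝ) ^ i) * (-1) ^ i = 1 := by rw [← mul_pow]; simp
    rw [h, neg_pow x i, smul_eq_mul]
    calc _ = ((-1 : ℝ) ^ i * (-1) ^ i) * ((i.factorial : ℝ)⁻¹ * i.factorial)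
          * (poch b i * N.choose i * (poch c i)⁻¹ * x ^ i) := by ring
      _ = _ := by rw [hs, inv_mul_cancel₀ hf]; ring
  · intro i hi
    rw [Finset.mem_range, not_lt] at hi
    rw [ascPochhammer_eval_neg_coe_nat_of_lt (by omega)]
    simp

/-- The linear functional `p ↦ a ∫₀¹ (1 - s) ^ (a - 1) p(s) ds` on polynomials. -/
noncomputable def betaFunctional (a : ℝ) : ℝ[X] →ₗ[ℝ] ℝ :=
  Polynomial.lsum fun j =>
    ((j.factorial : ℝ) * Real.Gamma (a + 1) / Real.Gamma (a + j + 1)) • LinearMap.id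

lemma betaFunctional_monomial (a c : ℝ) (j : ℕ) :
    betaFunctional a (monomial j c)
      = (j.factorial : ℝ) * Real.Gamma (a + 1) / Real.Gamma (a + j + 1) * c := by
  simp [betaFunctional, Polynomial.lsum_apply, Polynomial.sum_monomial_index]

lemma betaFunctional_X_pow (a : ℝ) (j : ℕ) :
    betaFunctional a (X ^ j)
      = (j.factorial : ℝ) * Real.Gamma (a + 1) / Real.Gamma (a + j + 1) := by
  rw [← monomial_one_right_eq_X_pow, betaFunctional_monomial, mul_one]

lemma betaFunctional_C_mul (a c : ℝ) (p : ℝ[X]) :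
    betaFunctional a (C c * p) = c * betaFunctional a p := by
  rw [← smul_eq_C_mul, map_smul, smul_eq_mul]

/-- Integration by parts for `betaFunctional`. -/
lemma betaFunctional_sub_derivative {a : ℝ} (ha : 0 < a) (p : ℝ[X]) :
    betaFunctional a (C a * p - (1 - X) * derivative p) = a * p.eval 0 := by
  induction p using Polynomial.induction_on' with
  | add p q hp hq =>
    rw [eval_add, mul_add a, ← hp, ← hq, ← map_add, derivative_add]
    congr 1
    ring
  | monomial n c =>
    cases n with
    | zero =>
      have := (Real.Gamma_pos_of_pos (by linarith : 0 < a + 1)).ne'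
      simp only [monomial_zero_left, derivative_C, mul_zero, sub_zero, eval_C]
      rw [← C_mul, ← monomial_zero_left, betaFunctional_monomial]
      simp [this]
    | succ n =>
      have h1 : 0 < a + n + 1 := by positivity
      have h2 := (Real.Gamma_pos_of_pos h1).ne'
      have h3 := Real.Gamma_add_one h1.ne'
      have e : C a * monomial (n + 1) c - (1 - X) * derivative (monomial (n + 1) c)
          = monomial (n + 1) (a * c + c * (n + 1)) - monomial n (c * (n + 1)) := by
        rw [derivative_monomial, sub_mul, X_mul_monomial, C_mul_monomial, one_mul, map_add]
        simp only [Nat.add_sub_cancel]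
        push_cast
        ring
      rw [e, map_sub, betaFunctional_monomial, betaFunctional_monomial]
      simp only [eval_monomial, Nat.cast_succ, ← add_assoc, h3, Nat.factorial_succ, Nat.cast_mul]
      simp only [ne_eq, Nat.add_eq_zero_iff, one_ne_zero, and_false, not_false_eq_true, zero_pow,
        mul_zero]
      field_simp
      ring

/-- The value is `a` times the beta integral `B(a + i, j + 1)`. Splitting one factor `1 - X` reduces
`i` at the cost of also needing `j + 1`, so `j` must stay general. -/
lemma betaFunctional_one_sub_pow_mul {a : ℝ} (ha : 0 < a) (i j : ℕ) :
    betaFunctional a ((1 - X) ^ i * X ^ j)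
      = (j.factorial : ℝ) * poch a i * Real.Gamma (a + 1) / Real.Gamma (a + i + j + 1) := by
  induction i generalizing j with
  | zero => simp [betaFunctional_X_pow, poch_zero]
  | succ i ih =>
    have e : ((1 - X) ^ (i + 1) * X ^ j : ℝ[X])
        = (1 - X) ^ i * X ^ j - (1 - X) ^ i * X ^ (j + 1) := by ring
    have h1 : 0 < a + i + j + 1 := by positivity
    have h2 := (Real.Gamma_pos_of_pos h1).ne'
    have h3 := Real.Gamma_add_one h1.ne'
    have h4 : a + ((i + 1 : ℕ) : ℝ) + j + 1 = a + i + j + 1 + 1 := by push_cast; ring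
    have h5 : a + i + ((j + 1 : ℕ) : ℝ) + 1 = a + i + j + 1 + 1 := by push_cast; ring
    rw [e, map_sub, ih, ih, h4, h5, h3, Nat.factorial_succ, poch, poch, ascPochhammer_succ_eval]
    push_cast
    field_simp
    ring

/-- Euler's integral for the terminating Gauss hypergeometric function. -/
lemma betaFunctional_eq_hypergeometric {a y v : ℝ} (ha : 0 < a) (hy : y ≠ 0) (e j K : ℕ) :
    betaFunctional a ((1 - X) ^ e * X ^ j * (C y + C v * (1 - X)) ^ K)
      = y ^ K * ((j.factorial : ℝ) * poch a e * Real.Gamma (a + 1) / Real.Gamma (a + e + j + 1))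
        * ordinaryHypergeometric (a + e) (-(K : ℝ)) (a + e + j + 1) (-(v / y)) := by
  rw [ordinaryHypergeometric_neg_natCast, add_comm (C y), add_pow, Finset.mul_sum, map_sum,
    Finset.mul_sum]
  refine Finset.sum_congr rfl fun i hi => ?_
  have hiK : i ≤ K := by simpa [Nat.lt_succ_iff] using hi
  have e1 : ((1 - X) ^ e * X ^ j * ((C v * (1 - X)) ^ i * C y ^ (K - i) * (K.choose i : ℝ[X])))
      = C (v ^ i * y ^ (K - i) * K.choose i) * ((1 - X) ^ (e + i) * X ^ j) := by
    simp only [C_mul, C_pow, map_natCast, mul_pow]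
    ring
  have h1 : 0 < a + e + j + 1 := by positivity
  have h2 := (Real.Gamma_pos_of_pos h1).ne'
  have h3 := (poch_pos h1 i).ne'
  have h4 : a + ((e + i : ℕ) : ℝ) + j + 1 = a + e + j + 1 + i := by push_cast; ring
  have h5 : y ^ K = y ^ (K - i) * y ^ i := by rw [← pow_add, Nat.sub_add_cancel hiK]
  rw [e1, betaFunctional_C_mul, betaFunctional_one_sub_pow_mul ha, h4, Gamma_add_natCast h1,
    poch_add, h5, div_pow]
  field_simp

/-- Only the first base is expanded, in powers of `X`; writing the second in `1 - X` lets Euler's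
integral absorb its whole power into one ₂F₁. -/
lemma betaFunctional_expand {a y v : ℝ} (ha : 0 < a) (hy : y ≠ 0) (z w : ℝ) (e M K : ℕ) :
    betaFunctional a ((1 - X) ^ e * (C z + C w * X) ^ M * (C y + C v * (1 - X)) ^ K)
      = ∑ j ∈ Finset.range (M + 1), (M.choose j : ℝ) * z ^ (M - j) * w ^ j
        * (y ^ K * ((j.factorial : ℝ) * poch a e * Real.Gamma (a + 1)
            / Real.Gamma (a + e + j + 1))
          * ordinaryHypergeometric (a + e) (-(K : ℝ)) (a + e + j + 1) (-(v / y))) := by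
  rw [add_comm (C z), add_pow, Finset.mul_sum, Finset.sum_mul, map_sum]
  refine Finset.sum_congr rfl fun j _ => ?_
  rw [← betaFunctional_eq_hypergeometric ha hy, ← betaFunctional_C_mul]
  congr 1
  simp only [C_mul, C_pow, map_natCast]
  ring

/-- The signs of `(-N)_i` and `(-x)^i` cancel, so no term is negative. This makes the denominator of
`g` nonzero. -/
lemma hypergeometric_neg_natCast_pos {b c x : ℝ} (hb : 0 < b) (hc : 0 < c) (hx : 0 ≤ x) (N : ℕ) :
    0 < ordinaryHypergeometric b (-(N : ℝ)) c (-x) := by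
  rw [ordinaryHypergeometric_neg_natCast]
  refine Finset.sum_pos' (fun i _ => ?_) ⟨0, by simp, by simp [poch_zero]⟩
  have := poch_pos hb i
  have := poch_pos hc i
  positivity

/-- Leibniz rule for independent particles: each factor `A` flips to `B` at rate `α`, each `B` to
`A` at rate `β`. The truncated exponents `p - 1` and `q - 1` are harmless, since their coefficients
vanish at 0. -/
lemma one_sub_X_mul_derivative {A B : ℝ[X]} (α β : ℝ)
    (hA : (1 - X) * derivative A = C α * (B - A)) (hB : (1 - X) * derivative B = -(C β * (B - A)))
    (p q : ℕ) :
    (1 - X) * derivative (A ^ p * B ^ q)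
      = C (α * p) * (A ^ (p - 1) * B ^ (q + 1) - A ^ p * B ^ q)
        + C (β * q) * (A ^ (p + 1) * B ^ (q - 1) - A ^ p * B ^ q) := by
  have key : (1 - X) * derivative (A ^ p * B ^ q)
      = (p : ℝ[X]) * A ^ (p - 1) * B ^ q * ((1 - X) * derivative A)
        + (q : ℝ[X]) * A ^ p * B ^ (q - 1) * ((1 - X) * derivative B) := by
    rw [derivative_mul, derivative_pow, derivative_pow]
    simp only [map_natCast]
    ring
  rw [key, hA, hB]
  simp only [C_mul, map_natCast]
  rcases p with _ | p <;> rcases q with _ | q <;>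
    simp only [Nat.add_sub_cancel, Nat.cast_add, Nat.cast_one, Nat.cast_zero] <;> ring

end Moments

/-! ### The level process, its balance equations and their integrated form -/

section Level

open Polynomial

/-- The generator of the level process without catastrophes. -/
noncomputable def levelGenerator (lam mu : ℝ) (N : ℕ) :
    Matrix (Fin (N + 1)) (Fin (N + 1)) ℝ := fun k j =>
  (if (j : ℕ) = k + 1 then lam * ((N : ℝ) - (k : ℕ)) else 0)
  + (if (k : ℕ) = j + 1 then mu * ((N : ℝ) + (k : ℕ)) else 0)
  - (if k = j then
      lam * ((N : ℝ) - (k : ℕ)) + (if 1 ≤ (k : ℕ) then mu * ((N : ℝ) + (k : ℕ)) else 0)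
     else 0)

/-- The weight `w` lives on all of `ℕ`, so no boundary cases are needed: the out-of-range value `w
(N + 1)` and the truncated `k - 1` at `k = 0` both get coefficient 0. -/
lemma sum_levelGenerator_smul {E : Type*} [AddCommGroup E] [Module ℝ E] (lam mu : ℝ) {N : ℕ}
    (k : Fin (N + 1)) (w : ℕ → E) :
    ∑ j, levelGenerator lam mu N k j • w j
      = (lam * ((N : ℝ) - (k : ℕ))) • (w (k + 1) - w k)
        + (if 1 ≤ (k : ℕ) then mu * ((N : ℝ) + (k : ℕ)) else 0) • (w (k - 1) - w k) := by
  have hk := k.2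
  have h1 : ∑ j : Fin (N + 1), (if (j : ℕ) = k + 1 then lam * ((N : ℝ) - (k : ℕ)) else 0) • w j
      = (lam * ((N : ℝ) - (k : ℕ))) • w (k + 1) := by
    rw [Fin.sum_univ_eq_sum_range
      (fun j => (if j = (k : ℕ) + 1 then lam * ((N : ℝ) - (k : ℕ)) else 0) • w j)]
    simp only [ite_smul, zero_smul, Finset.sum_ite_eq', Finset.mem_range]
    split_ifs with h
    · rfl
    · have : N = k := by omega
      simp [← this]
  have h2 : ∑ j : Fin (N + 1), (if (k : ℕ) = j + 1 then mu * ((N : ℝ) + (k : ℕ)) else 0) • w j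
      = (if 1 ≤ (k : ℕ) then mu * ((N : ℝ) + (k : ℕ)) else 0) • w (k - 1) := by
    rw [Fin.sum_univ_eq_sum_range
      (fun j => (if (k : ℕ) = j + 1 then mu * ((N : ℝ) + (k : ℕ)) else 0) • w j)]
    split_ifs with h
    · rw [Finset.sum_eq_single ((k : ℕ) - 1)]
      · rw [if_pos (by omega)]
      · intro j _ hj
        rw [if_neg (by omega), zero_smul]
      · intro hj
        exact absurd (Finset.mem_range.2 (by omega)) hj
    · rw [zero_smul]
      refine Finset.sum_eq_zero fun j _ => ?_
      rw [if_neg (by omega), zero_smul]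
  simp only [levelGenerator, sub_smul, add_smul, Finset.sum_sub_distrib, Finset.sum_add_distrib,
    h1, h2]
  simp only [ite_smul, zero_smul, Finset.sum_ite_eq, Finset.mem_univ, if_true, smul_sub, add_smul]
  split_ifs
  · abel
  · simp

lemma sum_levelGenerator (lam mu : ℝ) {N : ℕ} (k : Fin (N + 1)) :
    ∑ j, levelGenerator lam mu N k j = 0 := by
  simpa using sum_levelGenerator_smul lam mu k (fun _ => (1 : ℝ))

lemma levelGenerator_nonneg {lam mu : ℝ} (hlam : 0 ≤ lam) (hmu : 0 ≤ mu) {N : ℕ}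
    {k j : Fin (N + 1)} (h : k ≠ j) : 0 ≤ levelGenerator lam mu N k j := by
  have hk : (k : ℝ) ≤ N := by exact_mod_cast Nat.lt_succ_iff.1 k.2
  have : 0 ≤ lam * ((N : ℝ) - (k : ℕ)) := mul_nonneg hlam (by linarith)
  have : 0 ≤ mu * ((N : ℝ) + (k : ℕ)) := by positivity
  simp only [levelGenerator, if_neg h]
  split_ifs <;> linarith

/-- The balance equations of the level process with catastrophes. -/
def IsBalanced (lam mu xi : ℝ) {N : ℕ} (ρ : Fin (N + 1) → ℝ) : Prop :=
  ∀ j, ∑ k, ρ k * levelGenerator lam mu N k j = xi * (ρ j - if j = 0 then 1 else 0)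

lemma exists_isBalanced {lam mu xi : ℝ} (hlam : 0 ≤ lam) (hmu : 0 ≤ mu) (hxi : 0 < xi) (N : ℕ) :
    ∃ ρ : Fin (N + 1) → ℝ, IsBalanced lam mu xi ρ := by
  set Q := levelGenerator lam mu N with hQ
  set M : Matrix (Fin (N + 1)) (Fin (N + 1)) ℝ := xi • 1 - Q with hM
  have hdet : M.det ≠ 0 := by
    refine det_ne_zero_of_sum_row_lt_diag fun k => ?_
    have h0 : Q k k + ∑ j ∈ Finset.univ.erase k, Q k j = 0 := by
      rw [Finset.add_sum_erase _ _ (Finset.mem_univ k), hQ, sum_levelGenerator]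
    have h1 : ∑ j ∈ Finset.univ.erase k, ‖M k j‖ = ∑ j ∈ Finset.univ.erase k, Q k j := by
      refine Finset.sum_congr rfl fun j hj => ?_
      have hjk : k ≠ j := (Finset.ne_of_mem_erase hj).symm
      rw [hM, Matrix.sub_apply, Matrix.smul_apply, Matrix.one_apply_ne hjk, smul_zero, zero_sub,
        norm_neg, Real.norm_of_nonneg (levelGenerator_nonneg hlam hmu hjk)]
    have h2 : M k k = xi - Q k k := by simp [hM]
    rw [h1, h2]
    refine lt_of_lt_of_le ?_ (le_abs_self _)
    linarith
  -- This is `ξ δ₀ (ξ I - Q)⁻¹`, the law of the catastrophe-free level, started at 0, at an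
  -- exponential time of rate ξ.
  refine ⟨Matrix.vecMul (Pi.single 0 xi) M⁻¹, fun j => ?_⟩
  have hv : Matrix.vecMul (Matrix.vecMul (Pi.single 0 xi) M⁻¹) M = Pi.single 0 xi := by
    rw [Matrix.vecMul_vecMul, Matrix.nonsing_inv_mul _ (isUnit_iff_ne_zero.2 hdet),
      Matrix.vecMul_one]
  generalize Matrix.vecMul (Pi.single 0 xi) M⁻¹ = ρ at hv
  have := congrFun hv j
  rw [hM, Matrix.vecMul_sub, Matrix.vecMul_smul, Matrix.vecMul_one, Pi.sub_apply, Pi.smul_apply,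
    smul_eq_mul, Pi.single_apply] at this
  have h3 : Matrix.vecMul ρ Q j = ∑ k, ρ k * Q k j := rfl
  rw [← h3]
  split_ifs at this ⊢ <;> linarith

/-- Integration by parts applied to `G = ∑ ρ k W k`: the balance equations make `a G - (1 - X) G'`
equal to `a W 0` minus a multiple of `ρ 0`, the trace of the barrier at level 0. -/
lemma IsBalanced.pgf_identity {lam mu xi : ℝ} (hlam : 0 < lam) (hmu : 0 < mu) (hxi : 0 < xi)
    {N : ℕ} (hN : 1 ≤ N) {ρ : Fin (N + 1) → ℝ} (h : IsBalanced lam mu xi ρ) {a l m : ℝ}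
    (ha : a = xi / (lam + mu)) (hl : l = lam / (lam + mu)) (hm : m = mu / (lam + mu)) (z : ℝ) :
    z ^ N * ∑ k, ρ k * z ^ (k : ℕ)
      = betaFunctional a ((C z + C (m * (1 - z)) * X) ^ N
          * (C (1 - l * (1 - z)) + C (l * (1 - z)) * (1 - X)) ^ N)
        - ρ 0 * (m * N * (1 - z) / a)
          * betaFunctional a ((1 - X) * (C z + C (m * (1 - z)) * X) ^ (N - 1)
            * (C (1 - l * (1 - z)) + C (l * (1 - z)) * (1 - X)) ^ N) := by
  have hs : 0 < lam + mu := by linarith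
  have ha0 : 0 < a := by rw [ha]; positivity
  set A : ℝ[X] := C z + C (m * (1 - z)) * X with hA
  set B : ℝ[X] := C (1 - l * (1 - z)) + C (l * (1 - z)) * (1 - X) with hB
  have hlm : l = 1 - m := by rw [hl, hm]; field_simp; ring
  have hBA : B - A = C (1 - z) * (1 - X) := by
    rw [hA, hB, hlm]; simp only [C_mul, C_sub, C_1]; ring
  have hdA : (1 - X) * derivative A = C m * (B - A) := by
    rw [hBA, hA]; simp; ring
  have hdB : (1 - X) * derivative B = -(C l * (B - A)) := by
    rw [hBA, hB]; simp; ring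
  set W : ℕ → ℝ[X] := fun n => A ^ (N + n) * B ^ (N - n) with hW
  -- The extra term at `k = 0` is `μ N (W (-1) - W 0)`: the free particles may fall below level 0,
  -- whereas `levelGenerator` forbids it.
  have hdW : ∀ k : Fin (N + 1), (1 - X) * derivative (W k)
      = (lam + mu)⁻¹ • (∑ j, levelGenerator lam mu N k j • W j
        + if k = 0 then C (mu * N) * (A ^ (N - 1) * B ^ N * (B - A)) else 0) := by
    intro k
    have hk : (k : ℕ) ≤ N := Nat.lt_succ_iff.1 k.2
    have e1 : C (m * ((N + k : ℕ) : ℝ)) = C (lam + mu)⁻¹ * C (mu * ((N : ℝ) + (k : ℕ))) := by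
      rw [← C_mul, hm]; push_cast; congr 1; ring
    have e2 : C (l * ((N - k : ℕ) : ℝ)) = C (lam + mu)⁻¹ * C (lam * ((N : ℝ) - (k : ℕ))) := by
      rw [← C_mul, hl, Nat.cast_sub hk]; congr 1; ring
    have e3 : N - (k : ℕ) - 1 = N - (k + 1) := by omega
    rw [sum_levelGenerator_smul, hW, one_sub_X_mul_derivative m l hdA hdB, e1, e2]
    simp only [smul_eq_C_mul, e3, add_assoc]
    by_cases h0 : k = 0
    · subst h0
      obtain ⟨n, rfl⟩ : ∃ n, N = n + 1 := ⟨N - 1, by omega⟩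
      simp
      ring
    · have hk1 : 1 ≤ (k : ℕ) := by
        rw [Nat.one_le_iff_ne_zero]; exact fun hh => h0 (Fin.ext hh)
      have e4 : N + (k : ℕ) - 1 = N + (k - 1) := by omega
      have e5 : N - (k : ℕ) + 1 = N - (k - 1) := by omega
      rw [if_pos hk1, if_neg h0, e4, e5]
      ring
  set G : ℝ[X] := ∑ k : Fin (N + 1), ρ k • W k with hG
  have hdG : (1 - X) * derivative G = a • G - a • W 0
      + (ρ 0 * (m * N * (1 - z))) • ((1 - X) * A ^ (N - 1) * B ^ N) := by
    have e1 : ∑ k, ρ k • ∑ j, levelGenerator lam mu N k j • W j = xi • G - xi • W 0 := by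
      simp only [Finset.smul_sum, smul_smul]
      rw [Finset.sum_comm]
      simp only [← Finset.sum_smul, h _, mul_sub, sub_smul, Finset.sum_sub_distrib, hG,
        Finset.smul_sum, smul_smul]
      simp [ite_smul]
    have e2 : ∑ k : Fin (N + 1), ρ k •
        (if k = 0 then C (mu * N) * (A ^ (N - 1) * B ^ N * (B - A)) else 0)
        = ρ 0 • (C (mu * N) * (A ^ (N - 1) * B ^ N * (B - A))) := by
      simp
    have e3 : (1 - X) * derivative G = ∑ k, ρ k • ((1 - X) * derivative (W k)) := by
      rw [hG, derivative_sum, Finset.mul_sum]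
      simp
    rw [e3]
    simp only [hdW, smul_comm _ (lam + mu)⁻¹, smul_add, Finset.sum_add_distrib]
    rw [← Finset.smul_sum, ← Finset.smul_sum, e1, e2, hBA, ha, hm]
    simp only [smul_eq_C_mul, div_eq_mul_inv, C_mul]
    ring
  have hibp := betaFunctional_sub_derivative ha0 G
  -- At `X = 0` one has `A = z` and `B = 1`, so `W k` becomes `z ^ (N + k)`.
  have hGe : G.eval 0 = z ^ N * ∑ k, ρ k * z ^ (k : ℕ) := by
    rw [hG, eval_finsetSum, Finset.mul_sum]
    refine Finset.sum_congr rfl fun k _ => ?_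
    simp [hW, hA, hB, pow_add]
    ring
  rw [hdG, ← smul_eq_C_mul, hGe] at hibp
  have e4 : a • G - (a • G - a • W 0
      + (ρ 0 * (m * N * (1 - z))) • ((1 - X) * A ^ (N - 1) * B ^ N))
      = a • W 0 - (ρ 0 * (m * N * (1 - z))) • ((1 - X) * A ^ (N - 1) * B ^ N) := by abel
  have e5 : W 0 = A ^ N * B ^ N := by simp [hW]
  rw [e4, map_sub, map_smul, map_smul, smul_eq_mul, smul_eq_mul, e5] at hibp
  field_simp
  linarith

end Level

/-! ### Determination of `ρ 0` and comparison with the closed form -/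

section ClosedForm

open Polynomial

variable {lam mu xi a l m : ℝ}

/-- At `z = 0` the left side of `pgf_identity` vanishes because `N ≥ 1`, which leaves a linear
equation for `ρ 0`. -/
lemma IsBalanced.apply_zero (hlam : 0 < lam) (hmu : 0 < mu) (hxi : 0 < xi)
    {N : ℕ} (hN : 1 ≤ N) {ρ : Fin (N + 1) → ℝ} (h : IsBalanced lam mu xi ρ) :
    ρ 0 = g lam mu xi N := by
  have hs : 0 < lam + mu := by linarith
  obtain ⟨a, ha⟩ : ∃ a, a = xi / (lam + mu) := ⟨_, rfl⟩
  obtain ⟨l, hl⟩ : ∃ l, l = lam / (lam + mu) := ⟨_, rfl⟩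
  obtain ⟨m, hm⟩ : ∃ m, m = mu / (lam + mu) := ⟨_, rfl⟩
  have ha0 : 0 < a := by rw [ha]; positivity
  have hm0 : 0 < m := by rw [hm]; positivity
  have hlm : 1 - l * (1 - 0) = m := by rw [hl, hm]; field_simp; ring
  have hlm' : l * (1 - 0) / m = lam / mu := by rw [hl, hm]; field_simp; ring
  have key := h.pgf_identity hlam hmu hxi hN ha hl hm 0
  have hK := betaFunctional_expand (v := l * (1 - 0)) ha0 hm0.ne' 0 (m * (1 - 0)) 0 N N
  have hK' := betaFunctional_expand (v := l * (1 - 0)) ha0 hm0.ne' 0 (m * (1 - 0)) 1 (N - 1) N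
  rw [pow_zero, one_mul] at hK
  rw [pow_one] at hK'
  -- The powers of `z = 0` leave only the top index of each sum: `j = N` and `j = N - 1`.
  rw [hlm, hK, hK', Finset.sum_eq_single N, Finset.sum_eq_single (N - 1), hlm'] at key
  rotate_left
  · intro j hj hj'
    have : N - 1 - j ≠ 0 := by have := Finset.mem_range.1 hj; omega
    simp [this]
  · simp
  · intro j hj hj'
    have : N - j ≠ 0 := by have := Finset.mem_range.1 hj; omega
    simp [this]
  · simp
  obtain ⟨n, rfl⟩ : ∃ n, N = n + 1 := ⟨N - 1, by omega⟩
  have hc : 0 < a + n + 1 + 1 := by positivity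
  have e1 : a + ((0 : ℕ) : ℝ) + ((n + 1 : ℕ) : ℝ) + 1 = a + n + 1 + 1 := by push_cast; ring
  have e2 : a + ((1 : ℕ) : ℝ) + ((n : ℕ) : ℝ) + 1 = a + n + 1 + 1 := by push_cast; ring
  have e3 : a + ((n + 1 : ℕ) : ℝ) + 1 = a + n + 1 + 1 := by push_cast; ring
  have hF := hypergeometric_neg_natCast_pos (b := a + 1) (by linarith) hc
    (div_nonneg hlam.le hmu.le) (n + 1)
  have hG0 := Real.Gamma_pos_of_pos hc
  have hG1 := Real.Gamma_pos_of_pos (by linarith : 0 < a + 1)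
  have hp : poch a 1 = a := by simp [poch]
  simp only [Nat.add_sub_cancel, e1, e2, poch_zero, hp, Nat.choose_self, Nat.sub_self, pow_zero,
    Nat.factorial_succ] at key
  rw [g, ← ha, e3, neg_div, eq_div_iff hF.ne']
  have hfac : (0 : ℝ) < n.factorial := by positivity
  simp only [ne_eq, Nat.add_eq_zero_iff, one_ne_zero, and_false, not_false_eq_true, zero_pow,
    zero_mul, Nat.cast_zero, add_zero, Nat.cast_one, sub_zero, mul_one, one_mul, Nat.cast_mul]
    at key
  have hfactor : (ρ 0 * ordinaryHypergeometric (a + 1) (-((n + 1 : ℕ) : ℝ)) (a + n + 1 + 1)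
        (-(lam / mu))
      - ordinaryHypergeometric a (-((n + 1 : ℕ) : ℝ)) (a + n + 1 + 1) (-(lam / mu)))
      * (m ^ (n + 1) * m ^ (n + 1) * ((n + 1 : ℕ) : ℝ) * n.factorial * Real.Gamma (a + 1)
        / Real.Gamma (a + n + 1 + 1)) = 0 := by
    rw [← neg_eq_zero, key]
    field_simp
    ring
  have hne : (m ^ (n + 1) * m ^ (n + 1) * ((n + 1 : ℕ) : ℝ) * n.factorial * Real.Gamma (a + 1)
        / Real.Gamma (a + n + 1 + 1)) ≠ 0 := by positivity
  exact sub_eq_zero.1 ((mul_eq_zero.1 hfactor).resolve_right hne)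

lemma pow_mul_closedForm (hlam : 0 < lam) (hmu : 0 < mu) (hxi : 0 < xi)
    {N : ℕ} (hN : 1 ≤ N)
    (ha : a = xi / (lam + mu)) (hl : l = lam / (lam + mu)) (hm : m = mu / (lam + mu))
    {z : ℝ} (hz : 0 < z) :
    z ^ N * closedForm lam mu xi N z
      = betaFunctional a ((C z + C (m * (1 - z)) * X) ^ N
          * (C (1 - l * (1 - z)) + C (l * (1 - z)) * (1 - X)) ^ N)
        - g lam mu xi N * (m * N * (1 - z) / a)
          * betaFunctional a ((1 - X) * (C z + C (m * (1 - z)) * X) ^ (N - 1)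
            * (C (1 - l * (1 - z)) + C (l * (1 - z)) * (1 - X)) ^ N) := by
  have hs : 0 < lam + mu := by linarith
  have ha0 : 0 < a := by rw [ha]; positivity
  have hY : 0 < lam * z + mu := by positivity
  have hy : 1 - l * (1 - z) = (lam * z + mu) / (lam + mu) := by rw [hl]; field_simp; ring
  have hx : l * (1 - z) / ((lam * z + mu) / (lam + mu)) = lam * (1 - z) / (lam * z + mu) := by
    rw [hl]; field_simp
  have hy0 : (lam * z + mu) / (lam + mu) ≠ 0 := by positivity
  have hK := betaFunctional_expand (v := l * (1 - z)) ha0 hy0 z (m * (1 - z)) 0 N N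
  have hK' := betaFunctional_expand (v := l * (1 - z)) ha0 hy0 z (m * (1 - z)) 1 (N - 1) N
  rw [pow_zero, one_mul] at hK
  rw [pow_one] at hK'
  rw [hy, hK, hK', hx, closedForm, ← ha, Nat.sub_add_cancel hN, mul_add,
    sub_eq_add_neg (Finset.sum _ _), add_comm (Finset.sum _ _)]
  have hmm : m * (1 - z) = mu * (1 - z) / (lam + mu) := by rw [hm]; ring
  have hp : poch a 1 = a := by simp [poch]
  congr 1
  · rw [Finset.mul_sum, Finset.mul_sum, Finset.mul_sum, ← Finset.sum_neg_distrib]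
    refine Finset.sum_congr rfl fun j hj => ?_
    have hj' : j < N := Finset.mem_range.1 hj
    have e1 : a + ((1 : ℕ) : ℝ) + (j : ℝ) + 1 = j + a + 2 := by push_cast; ring
    have e2 : a + (j : ℝ) + 2 = j + a + 2 := by ring
    have e3 : N - j - 1 = N - 1 - j := by omega
    -- The factors of `λ + μ` pair off with `((λ+μ)z)^(N-1-j)`, with `m^j`, with the `m` in the
    -- prefactor and with the `N`-th power of `(λz+μ)/(λ+μ)`.
    have e4 : (lam + mu) ^ (2 * N)
        = (lam + mu) ^ (N - 1 - j) * (lam + mu) ^ j * (lam + mu) * (lam + mu) ^ N := by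
      rw [← pow_add, ← pow_succ, ← pow_add]; congr 1; omega
    have e5 : m * N * (1 - z) / a = mu * (1 - z) / (lam + mu) * N / a := by rw [← hmm]; ring
    rw [e1, e2, e3, hmm, e4, e5, hp, Real.Gamma_nat_eq_factorial, div_pow, div_pow, mul_pow,
      ← neg_div, Nat.cast_one]
    field_simp
  · rw [Finset.mul_sum, Finset.mul_sum]
    refine Finset.sum_congr rfl fun j hj => ?_
    have hj' : j < N + 1 := Finset.mem_range.1 hj
    have e1 : a + ((0 : ℕ) : ℝ) + (j : ℝ) + 1 = j + a + 1 := by push_cast; ring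
    have e2 : a + (j : ℝ) + 1 = j + a + 1 := by ring
    have e4 : (lam + mu) ^ (2 * N)
        = (lam + mu) ^ (N - j) * (lam + mu) ^ j * (lam + mu) ^ N := by
      rw [← pow_add, ← pow_add]; congr 1; omega
    rw [e1, e2, hmm, e4, poch_zero, Real.Gamma_nat_eq_factorial, div_pow, div_pow, mul_pow,
      ← neg_div, Nat.cast_zero, add_zero]
    field_simp

lemma IsBalanced.pgf_eq_closedForm (hlam : 0 < lam) (hmu : 0 < mu) (hxi : 0 < xi)
    {N : ℕ} (hN : 1 ≤ N) {ρ : Fin (N + 1) → ℝ} (h : IsBalanced lam mu xi ρ)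
    {z : ℝ} (hz : 0 < z) :
    ∑ k, ρ k * z ^ (k : ℕ) = closedForm lam mu xi N z := by
  refine mul_left_cancel₀ (pow_pos hz N).ne' ?_
  rw [pow_mul_closedForm hlam hmu hxi hN rfl rfl rfl hz,
    h.pgf_identity hlam hmu hxi hN rfl rfl rfl z, h.apply_zero hlam hmu hxi hN]

end ClosedForm

/-! ### Lumping of the phases and convergence of the level law -/

section Dynamics

/-- A bounded nonnegative function that contracts, up to `o(h)`, by the factor `1 - ξ h` in time
`h` tends to zero. -/
lemma tendsto_zero_of_contraction {f : ℝ → ℝ} {xi M : ℝ} (hxi : 0 < xi)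
    (hf : ∀ t, 0 ≤ t → 0 ≤ f t) (hM : ∀ t, 0 ≤ t → f t ≤ M)
    (h : ∀ ε > 0, ∀ᶠ s in 𝓝[>] (0 : ℝ), ∀ t, 0 ≤ t → f (t + s) ≤ (1 - xi * s) * f t + s * ε) :
    Tendsto f atTop (𝓝 0) := by
  rw [Metric.tendsto_atTop]
  intro ε hε
  -- With error rate `ξ ε / 2`, the fixed point of the recursion with step `s` is `ε / 2`;
  -- subtracting it leaves pure geometric decay.
  obtain ⟨s, hs, hs0, hs1⟩ := ((h (xi * (ε / 2)) (by positivity)).and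
    (Ioo_mem_nhdsGT (by positivity : (0 : ℝ) < 1 / xi))).exists
  have hq : xi * s < 1 := by rw [mul_comm]; exact (lt_div_iff₀ hxi).1 hs1
  have hq0 : 0 < xi * s := by positivity
  have iter : ∀ n : ℕ, ∀ r, 0 ≤ r → f (r + n * s) - ε / 2 ≤ (1 - xi * s) ^ n * M := by
    intro n
    induction n with
    | zero => intro r hr; have := hM r hr; simp; linarith
    | succ n ih =>
      intro r hr
      have h1 := hs (r + n * s) (by positivity)
      have h2 := mul_le_mul_of_nonneg_left (ih r hr) (by linarith : 0 ≤ 1 - xi * s)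
      have e : r + ((n + 1 : ℕ) : ℝ) * s = r + n * s + s := by push_cast; ring
      rw [e, pow_succ']
      linarith
  have hlim : Tendsto (fun n : ℕ => (1 - xi * s) ^ n * M) atTop (𝓝 0) := by
    simpa using (tendsto_pow_atTop_nhds_zero_of_lt_one (by linarith) (by linarith)).mul_const M
  obtain ⟨n, hn⟩ := (hlim.eventually (gt_mem_nhds (by positivity : (0 : ℝ) < ε / 2))).exists
  refine ⟨n * s, fun t ht => ?_⟩
  have := iter n (t - n * s) (by linarith)
  rw [sub_add_cancel] at this
  rw [Real.dist_0_eq_abs, abs_of_nonneg (hf t (by nlinarith [Nat.cast_nonneg (α := ℝ) n]))]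
  linarith

/-- Lumpability: the result does not depend on the phase `x.2`. The catastrophe term needs no case
split, as its two indicators cancel at level 0. -/
lemma sum_generator_phase {lam mu xi : ℝ} {d N : ℕ} {C : Matrix (Fin d) (Fin d) ℝ}
    (hC : C ∈ Matrix.rowStochastic ℝ (Fin d)) (x : Fin (N + 1) × Fin d) (k : Fin (N + 1)) :
    ∑ j, generator lam mu xi d N C x (k, j)
      = levelGenerator lam mu N x.1 k
        + xi * ((if k = 0 then 1 else 0) - if k = x.1 then 1 else 0) := by
  obtain ⟨i, l⟩ := x
  have hk0 : k = 0 ↔ (k : ℕ) = 0 := by rw [Fin.ext_iff]; rfl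
  have hki : k = i ↔ (k : ℕ) = i := Fin.ext_iff
  have hik : i = k ↔ (i : ℕ) = k := Fin.ext_iff
  have hrow := Matrix.sum_row_of_mem_rowStochastic hC l
  have h1 : ∑ j, (if (i : ℕ) = 0 ∧ (k : ℕ) = 1 then C l j * (lam * N) else 0)
      = if (i : ℕ) = 0 ∧ (k : ℕ) = 1 then lam * N else 0 := by
    split_ifs
    · rw [← Finset.sum_mul, hrow, one_mul]
    · simp
  have h2 : ∀ (p q : Prop) [Decidable p] [Decidable q] (c : ℝ),
      ∑ j, (if p ∧ q ∧ j = l then c else 0) = if p ∧ q then c else 0 := by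
    intro p q _ _ c
    by_cases hp : p <;> by_cases hq : q <;> simp [hp, hq]
  have h3 : ∀ (p : Prop) [Decidable p] (c : ℝ),
      ∑ j, (if p ∧ j = l then c else 0) = if p then c else 0 := by
    intro p _ c
    by_cases hp : p <;> simp [hp]
  have h4 : ∀ (p : Prop) [Decidable p] (c : ℝ),
      ∑ j, (if p ∧ l = j then c else 0) = if p then c else 0 := by
    intro p _ c
    by_cases hp : p <;> simp [hp]
  have h5 : ∑ j, (if 1 ≤ (i : ℕ) ∧ (k : ℕ) = 0 ∧ j = l then xi else 0)
      = if 1 ≤ (i : ℕ) ∧ (k : ℕ) = 0 then xi else 0 := by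
    by_cases hp : 1 ≤ (i : ℕ) <;> by_cases hq : (k : ℕ) = 0 <;> simp [hp, hq]
  simp only [generator, levelGenerator, Finset.sum_sub_distrib, Finset.sum_add_distrib,
    Prod.mk.injEq, h1, h2, h3, h5, h4, hk0, hki, hik]
  rcases Nat.eq_zero_or_pos (i : ℕ) with hi | hi
  · simp only [hi, true_and, zero_add]
    split_ifs <;> first | omega | (push_cast; ring)
  · split_ifs <;> first | omega | ring

variable {Ω : Type*} [MeasurableSpace Ω] {Pr : Measure Ω} [IsProbabilityMeasure Pr]

section StateSpace

variable {S : Type*} [Fintype S] [MeasurableSpace S] [MeasurableSingletonClass S]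

lemma sum_measureReal_inter_fiber {Y : Ω → S} (hY : Measurable Y) {H : Set Ω} :
    ∑ x, Pr.real (H ∩ {ω | Y ω = x}) = Pr.real H := by
  classical
  have hms : ∀ x, MeasurableSet {ω | Y ω = x} := fun x => hY (measurableSet_singleton x)
  have := measureReal_biUnion_finset (μ := Pr.restrict H) (s := Finset.univ)
    (f := fun x => {ω | Y ω = x})
    (fun x _ y _ hxy => Set.disjoint_left.2 fun ω hx hy => hxy (hx.symm.trans hy))
    (fun x _ => hms x)
  have hU : (⋃ x ∈ (Finset.univ : Finset S), {ω | Y ω = x}) = Set.univ := by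
    ext ω; simp
  rw [hU, measureReal_restrict_apply MeasurableSet.univ, Set.univ_inter] at this
  rw [this]
  refine Finset.sum_congr rfl fun x _ => ?_
  rw [measureReal_restrict_apply (hms x), Set.inter_comm]

lemma IsMarkovJumpProcess.law_add [DecidableEq S] {Q : Matrix S S ℝ} {x₀ : S} {X : ℝ → Ω → S}
    (hX : IsMarkovJumpProcess Pr Q x₀ X) :
    ∃ T : ℝ → Matrix S S ℝ, IsTransitionFunction Q T ∧ ∀ s t, 0 ≤ s → 0 ≤ t → ∀ y,
      Pr.real {ω | X (s + t) ω = y} = ∑ x, Pr.real {ω | X s ω = x} * T t x y := by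
  obtain ⟨T, hT, hm⟩ := hX.markov
  refine ⟨T, hT, fun s t hs ht y => ?_⟩
  rw [← sum_measureReal_inter_fiber (Pr := Pr) (hX.measurable s hs) (H := {ω | X (s + t) ω = y})]
  refine Finset.sum_congr rfl fun x _ => ?_
  have := hm s t hs ht Set.univ MeasurableSet.univ x y
  rwa [Set.univ_inter, Set.inter_comm] at this

end StateSpace

variable {d N : ℕ} {X : ℝ → Ω → Fin (N + 1) × Fin d}

lemma levelProb_eq_sum {t : ℝ} (hX : Measurable (X t)) (k : Fin (N + 1)) :
    levelProb Pr X k t = ∑ j, Pr.real {ω | X t ω = (k, j)} := by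
  rw [levelProb, ← sum_measureReal_inter_fiber (Pr := Pr) hX.snd]
  refine Finset.sum_congr rfl fun j _ => ?_
  congr 1
  ext ω
  simp [Prod.ext_iff]

lemma sum_levelProb {t : ℝ} (hX : Measurable (X t)) : ∑ k, levelProb Pr X k t = 1 := by
  have := sum_measureReal_inter_fiber (Pr := Pr) hX.fst (H := Set.univ)
  simpa [levelProb] using this

lemma levelPGF_eq_sum {t : ℝ} (hX : Measurable (X t)) (z : ℝ) :
    levelPGF Pr X z t = ∑ k : Fin (N + 1), levelProb Pr X k t * z ^ (k : ℕ) := by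
  have h1 : levelPGF Pr X z t = ∫ k : Fin (N + 1), z ^ (k : ℕ) ∂(Pr.map fun ω => (X t ω).1) := by
    rw [integral_map hX.fst.aemeasurable (by fun_prop)]
    rfl
  have : IsProbabilityMeasure (Pr.map fun ω => (X t ω).1) :=
    Measure.isProbabilityMeasure_map hX.fst.aemeasurable
  rw [h1, integral_fintype Integrable.of_finite]
  refine Finset.sum_congr rfl fun k _ => ?_
  rw [map_measureReal_apply hX.fst (measurableSet_singleton k), smul_eq_mul]
  rfl

/-- The one-step estimate: `p(t + h) = p(t) + h p(t) Q + o(h)` uniformly in `t`, where `Q` is the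
generator of the level process. -/
lemma IsCatastropheQBD.levelProb_add {lam mu xi : ℝ} {C : Matrix (Fin d) (Fin d) ℝ}
    (hC : C ∈ Matrix.rowStochastic ℝ (Fin d)) {l₀ : Fin d}
    (hX : IsCatastropheQBD Pr lam mu xi d N C l₀ X) {ε : ℝ} (hε : 0 < ε) :
    ∀ᶠ h in 𝓝[>] (0 : ℝ), ∀ t, 0 ≤ t → ∀ k, |levelProb Pr X k (t + h)
      - (levelProb Pr X k t + h * (∑ i, levelProb Pr X i t * levelGenerator lam mu N i k
        + xi * ((if k = 0 then 1 else 0) - levelProb Pr X k t)))| ≤ h * ε := by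
  obtain ⟨T, hT, hlaw⟩ := IsMarkovJumpProcess.law_add hX
  have hmeas := hX.measurable
  have hrate : ∀ x : Fin (N + 1) × Fin d, ∀ k : Fin (N + 1),
      ∀ᶠ h in 𝓝[>] (0 : ℝ), |∑ j, (T h x (k, j) - (1 : Matrix _ _ ℝ) x (k, j)) / h
        - (levelGenerator lam mu N x.1 k
          + xi * ((if k = 0 then 1 else 0) - if k = x.1 then 1 else 0))| ≤ ε := by
    intro x k
    have := tendsto_finsetSum Finset.univ fun j _ => hT.rates x (k, j)
    rw [sum_generator_phase hC] at this
    filter_upwards [Metric.tendsto_nhds.1 this ε hε] with h hh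
    exact hh.le
  filter_upwards [eventually_all.2 fun x => eventually_all.2 (hrate x), self_mem_nhdsWithin]
    with h hh hpos t ht k
  have hpos : 0 < h := hpos
  have hq : ∑ x, Pr.real {ω | X t ω = x} = 1 := by
    simpa using sum_measureReal_inter_fiber (Pr := Pr) (hmeas t ht) (H := Set.univ)
  set q : Fin (N + 1) × Fin d → ℝ := fun x => Pr.real {ω | X t ω = x} with hqdef
  have hq0 : ∀ x, 0 ≤ q x := fun x => measureReal_nonneg
  have hp : ∀ i, levelProb Pr X i t = ∑ j, q (i, j) := fun i => levelProb_eq_sum (hmeas t ht) i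
  have hlump : ∀ c : Fin (N + 1) → ℝ, ∑ i, levelProb Pr X i t * c i = ∑ x, q x * c x.1 := by
    intro c
    rw [Fintype.sum_prod_type]
    simp only [hp, Finset.sum_mul]
  have hone : ∀ x : Fin (N + 1) × Fin d,
      ∑ j, (1 : Matrix (Fin (N + 1) × Fin d) (Fin (N + 1) × Fin d) ℝ) x (k, j)
        = if k = x.1 then 1 else 0 := by
    rintro ⟨i, l⟩
    simp only [Matrix.one_apply, Prod.mk.injEq, ite_and]
    by_cases hik : i = k
    · simp [hik]
    · simp [hik, Ne.symm hik]
  have hnew : levelProb Pr X k (t + h) = ∑ x, q x * ∑ j, T h x (k, j) := by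
    rw [levelProb_eq_sum (hmeas _ (by positivity))]
    simp only [hlaw t h ht hpos.le, Finset.mul_sum]
    rw [Finset.sum_comm]
  have hself : levelProb Pr X k t = ∑ x, q x * (if k = x.1 then 1 else 0) := by
    rw [← hlump fun i => if k = i then 1 else 0]
    simp
  have e : levelProb Pr X k (t + h)
      - (levelProb Pr X k t + h * (∑ i, levelProb Pr X i t * levelGenerator lam mu N i k
        + xi * ((if k = 0 then 1 else 0) - levelProb Pr X k t)))
      = ∑ x, q x * (h * (∑ j, (T h x (k, j) - (1 : Matrix _ _ ℝ) x (k, j)) / h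
        - (levelGenerator lam mu N x.1 k
          + xi * ((if k = 0 then 1 else 0) - if k = x.1 then 1 else 0)))) := by
    have e1 : (if k = 0 then (1 : ℝ) else 0) = ∑ x, q x * (if k = 0 then 1 else 0) := by
      rw [← Finset.sum_mul, hq, one_mul]
    rw [hnew, hlump, hself, e1]
    simp only [← Finset.sum_div, Finset.sum_sub_distrib, hone]
    rw [← Finset.sum_sub_distrib, Finset.mul_sum, ← Finset.sum_add_distrib, Finset.mul_sum,
      ← Finset.sum_add_distrib, ← Finset.sum_sub_distrib]
    refine Finset.sum_congr rfl fun x _ => ?_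
    rw [← e1]
    field_simp
    ring
  rw [e]
  calc _ ≤ ∑ x, q x * (h * ε) := by
        refine (Finset.abs_sum_le_sum_abs _ _).trans (Finset.sum_le_sum fun x _ => ?_)
        rw [abs_mul, abs_mul, abs_of_nonneg (hq0 x), abs_of_pos hpos]
        exact mul_le_mul_of_nonneg_left (mul_le_mul_of_nonneg_left (hh x k) hpos.le) (hq0 x)
    _ = h * ε := by rw [← Finset.sum_mul, hq, one_mul]

/-- For small `h` the matrix `(1 - ξ h) I + h Q` has nonnegative entries, and its rows sum to `1 - ξ
h` because those of `Q` sum to 0. -/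
lemma sum_abs_vecMul_le {lam mu xi : ℝ} (hlam : 0 ≤ lam) (hmu : 0 ≤ mu) {N : ℕ} :
    ∀ᶠ h in 𝓝[>] (0 : ℝ), ∀ v : Fin (N + 1) → ℝ,
      ∑ k, |v k + h * (∑ i, v i * levelGenerator lam mu N i k - xi * v k)|
        ≤ (1 - xi * h) * ∑ k, |v k| := by
  have hdiag : ∀ i : Fin (N + 1), ∀ᶠ h in 𝓝[>] (0 : ℝ),
      0 ≤ 1 - xi * h + h * levelGenerator lam mu N i i := by
    intro i
    have : Tendsto (fun h : ℝ => 1 - xi * h + h * levelGenerator lam mu N i i) (𝓝[>] 0) (𝓝 1) := by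
      have hc : Continuous fun h : ℝ => 1 - xi * h + h * levelGenerator lam mu N i i := by
        fun_prop
      simpa using (hc.tendsto 0).mono_left nhdsWithin_le_nhds
    filter_upwards [this.eventually (lt_mem_nhds zero_lt_one)] with h hh
    exact hh.le
  filter_upwards [eventually_all.2 hdiag, self_mem_nhdsWithin] with h hh hpos v
  have hpos : 0 < h := hpos
  have hnn : ∀ i k, 0 ≤ (if i = k then 1 - xi * h else 0) + h * levelGenerator lam mu N i k := by
    intro i k
    split_ifs with hik
    · subst hik; exact hh i
    · rw [zero_add]; exact mul_nonneg hpos.le (levelGenerator_nonneg hlam hmu hik)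
  calc _ = ∑ k, |∑ i, v i *
          ((if i = k then 1 - xi * h else 0) + h * levelGenerator lam mu N i k)| := by
        refine Finset.sum_congr rfl fun k _ => ?_
        congr 1
        simp only [mul_add, Finset.sum_add_distrib, mul_ite, mul_zero, Finset.sum_ite_eq',
          Finset.mem_univ, if_true, mul_left_comm _ h, ← Finset.mul_sum]
        ring
    _ ≤ ∑ k, ∑ i, |v i| *
          ((if i = k then 1 - xi * h else 0) + h * levelGenerator lam mu N i k) := by
        refine Finset.sum_le_sum fun k _ => (Finset.abs_sum_le_sum_abs _ _).trans
          (Finset.sum_le_sum fun i _ => ?_)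
        rw [abs_mul, abs_of_nonneg (hnn i k)]
    _ = _ := by
        rw [Finset.sum_comm, Finset.mul_sum]
        refine Finset.sum_congr rfl fun i _ => ?_
        rw [← Finset.mul_sum, Finset.sum_add_distrib, ← Finset.mul_sum, sum_levelGenerator]
        simp [mul_comm]

/-- The law of the level converges to every solution of the balance equations. -/
lemma IsCatastropheQBD.tendsto_levelProb {lam mu xi : ℝ} (hlam : 0 ≤ lam) (hmu : 0 ≤ mu)
    (hxi : 0 < xi) {C : Matrix (Fin d) (Fin d) ℝ}
    (hC : C ∈ Matrix.rowStochastic ℝ (Fin d)) {l₀ : Fin d}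
    (hX : IsCatastropheQBD Pr lam mu xi d N C l₀ X) {ρ : Fin (N + 1) → ℝ}
    (hρ : IsBalanced lam mu xi ρ) (k : Fin (N + 1)) :
    Tendsto (levelProb Pr X k) atTop (𝓝 (ρ k)) := by
  have hmeas := hX.measurable
  have key : Tendsto (fun t => ∑ k, |levelProb Pr X k t - ρ k|) atTop (𝓝 0) := by
    refine tendsto_zero_of_contraction (M := 1 + ∑ k, |ρ k|) hxi
      (fun t _ => Finset.sum_nonneg fun k _ => abs_nonneg _) (fun t ht => ?_) fun ε hε => ?_
    · rw [← sum_levelProb (Pr := Pr) (hmeas t ht), ← Finset.sum_add_distrib]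
      refine Finset.sum_le_sum fun k _ => (abs_sub _ _).trans ?_
      rw [abs_of_nonneg (a := levelProb Pr X k t) measureReal_nonneg]
    · have hε' : 0 < ε / (N + 1) := by positivity
      filter_upwards [hX.levelProb_add hC hε', sum_abs_vecMul_le (N := N) (xi := xi) hlam hmu]
        with h h1 h2 t ht
      have h3 := h2 fun k => levelProb Pr X k t - ρ k
      calc ∑ k, |levelProb Pr X k (t + h) - ρ k|
          ≤ ∑ k, (|levelProb Pr X k t - ρ k
              + h * (∑ i, (levelProb Pr X i t - ρ i) * levelGenerator lam mu N i k
                - xi * (levelProb Pr X k t - ρ k))| + h * (ε / (N + 1))) := by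
            refine Finset.sum_le_sum fun k _ => ?_
            refine le_trans (le_of_eq ?_)
              ((abs_add_le _ _).trans (add_le_add_right (h1 t ht k) _))
            congr 1
            -- The balance equation for ρ cancels the source term at level 0, leaving the
            -- homogeneous evolution of the difference.
            simp only [sub_mul, Finset.sum_sub_distrib, hρ k]
            ring
        _ ≤ (1 - xi * h) * ∑ k, |levelProb Pr X k t - ρ k| + h * ε := by
            rw [Finset.sum_add_distrib]
            refine add_le_add h3 (le_of_eq ?_)
            simp only [Finset.sum_const, Finset.card_univ, Fintype.card_fin, nsmul_eq_mul]
            push_cast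
            field_simp
  rw [tendsto_iff_dist_tendsto_zero]
  refine squeeze_zero (fun _ => dist_nonneg) (fun t => ?_) key
  rw [Real.dist_eq]
  exact Finset.single_le_sum (f := fun k => |levelProb Pr X k t - ρ k|)
    (fun _ _ => abs_nonneg _) (Finset.mem_univ k)

end Dynamics

end QBD

theorem mainTheorem3 (lam mu xi : ℝ) (hlam : 0 < lam) (hmu : 0 < mu) (hxi : 0 < xi)
    (d N : ℕ) (hd : 1 ≤ d) (hN : 1 ≤ N)
    (C : Matrix (Fin d) (Fin d) ℝ) (hC : C ∈ Matrix.rowStochastic ℝ (Fin d))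
    (hCirr : C.IsIrreducible) (l₀ : Fin d)
    {Ω : Type*} [MeasurableSpace Ω] (Pr : Measure Ω) [IsProbabilityMeasure Pr]
    (X : ℝ → Ω → Fin (N + 1) × Fin d)
    (hX : QBD.IsCatastropheQBD Pr lam mu xi d N C l₀ X) :
    ∃ (ρ : Fin (N + 1) → ℝ) (F : ℝ → ℝ),
      (∀ k, Tendsto (QBD.levelProb Pr X k) atTop (𝓝 (ρ k))) ∧
      (∀ z ∈ Set.Icc (0 : ℝ) 1, Tendsto (QBD.levelPGF Pr X z) atTop (𝓝 (F z))) ∧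
      (∀ z ∈ Set.Icc (0 : ℝ) 1, F z = ∑ k, ρ k * z ^ (k : ℕ)) ∧
      (∀ z ∈ Set.Ioc (0 : ℝ) 1, F z = QBD.closedForm lam mu xi N z) := by
  obtain ⟨ρ, hρ⟩ := QBD.exists_isBalanced hlam.le hmu.le hxi N
  have hlim := fun k => hX.tendsto_levelProb hlam.le hmu.le hxi hC hρ k
  refine ⟨ρ, fun z => ∑ k, ρ k * z ^ (k : ℕ), hlim, fun z _ => ?_, fun _ _ => rfl,
    fun z hz => hρ.pgf_eq_closedForm hlam hmu hxi hN hz.1⟩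
  refine (tendsto_finsetSum Finset.univ fun k _ => (hlim k).mul_const (z ^ (k : ℕ))).congr' ?_
  filter_upwards [eventually_ge_atTop 0] with t ht
  exact (QBD.levelPGF_eq_sum (hX.measurable t ht) z).symm
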